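/- **Setting.** $n$ users are located in the unit square. Under the protocol model with transmission range $r>0$ and guard parameter $\Delta>0$, links (transmitter, receiver) can be active simultaneously iff every receiver is at distance at most $r$ from its own transmitter and at distance at least $(1+\Delta)r$ from every other transmitting user. There are $m$ independent files, each uniform on $\mathbb F_2^F$ and split into $K$ packets of equal size. Each user caches at most $MK$ packets (that is, $MF$ bits). For a demand vector $(f_u)_u$, each user transmits bits that depend only on its own cache and on the demands; the *rate* is the total number of transmitted bits divided by $F$. User $u$ decodes file $f_u$ from the messages received under a feasible schedule of links, its own cache and the demands. The pair $(M,R)$ is *achieved* by a family of schemes with $F\to\infty$ if, for every $\varepsilon>0$ and suitable decoders, $\limsup_F R^{(F)}\le R$ and $\limsup_F P_e^{(F)}\le\varepsilon$, where $P_e^{(F)}$ is the maximum error probability over all demand vectors and users. A $(\gamma,\tau)$-*Ruzsa–Szemerédi (RS) graph* is a graph whose edge set is the union of $\tau$ pairwise disjoint induced matchings, each of size $\gamma$. The *RS scheme* of such a graph on the set of users has $K=(2\gamma-1)n$ packets per file, $2\gamma-1$ for each vertex. User $u$ caches, for every file, the packets of all vertices not adjacent to $u$ (including $u$). In each of the $\tau$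 matchings, each of the $2\gamma$ nodes transmits the XOR of $2\gamma-1$ packets, one for each other node $p$ of the matching: a packet, of the file requested by $p$, that belongs to the vertex matched to $p$; different senders use different packets for $p$. **Corollary 1.** There are absolute constants $c_1,c_2>0$ such that the following holds for integers $\Lambda>10.5^2$ and $z\ge 2\Lambda$, with $n=\Lambda^z$ and $\delta=\frac{2\ln 10.5}{\ln\Lambda}$. One has $c_1\delta e^{-c_2/\delta}=\frac{1}{2\Lambda^4\ln\Lambda}$, and there is a $(\gamma,\tau)$-RS graph on the $n$ users, with $\gamma\ge1$, such that $$K=(2\gamma-1)n=O\left(n^{2-\delta}\right),\qquad R^{\rm RS}=\frac{\tau}{n}\,\frac{2\gamma}{2\gamma-1}\le n^{\delta}+o\left(n^{\delta}\right)\quad (n\to\infty),$$ and such that for every $m$, for every placement of the users in the unit square, and for all $r\ge\sqrt2$ and $\Delta>0$, the RS scheme of this graph achieves the pair $(M,R^{\rm RS})$ with $$M=2m\,n^{-c_1\delta\exp(-c_2/\delta)}.$$ The $O$ and $o$ are uniform in $\Lambda$ and $z$. -/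

import Mathlib

open Filter Topology

noncomputable section

/-! ### Single-hop wireless D2D network under the protocol model -/

/-- A D2D network: `n` users located in the unit square, with the transmission range `r > 0` and the
guard parameter `Δ > 0` of the protocol model. -/
structure D2DNetwork (n : ℕ) where
  pos : Fin n → EuclideanSpace ℝ (Fin 2)
  pos_mem : ∀ u i, pos u i ∈ Set.Icc (0 : ℝ) 1
  r : ℝ
  r_pos : 0 < r
  Δ : ℝ
  Δ_pos : 0 < Δ

namespace D2DNetwork

variable {n : ℕ}

/-- A set `A` of directed links `(transmitter, receiver)` can be active simultaneously: every
receiver is within distance `r` of its transmitter and at distance at least `(1 + Δ) r` from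
every other transmitting user. -/
def Feasible (net : D2DNetwork n) (A : Set (Fin n × Fin n)) : Prop :=
  ∀ l ∈ A, l.1 ≠ l.2 ∧ dist (net.pos l.1) (net.pos l.2) ≤ net.r ∧
    ∀ l' ∈ A, l'.1 ≠ l.1 → (1 + net.Δ) * net.r ≤ dist (net.pos l'.1) (net.pos l.2)

end D2DNetwork

/-- The set of users whose messages are received by user `u` under the transmission policy `A`
(`A s` is the set of links active at time `s`): those whose link to `u` is active infinitely often,
so that messages of any length get through. -/
def receivedFrom {n : ℕ} (A : ℕ → Set (Fin n × Fin n)) (u : Fin n) : Set (Fin n) :=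
  {v | ∃ᶠ s in atTop, (v, u) ∈ A s}

/-! ### D2D caching schemes -/

/-- A library of `m` files, each of them split into packets labelled by `P`, with `L` bits per
packet. A file has `F = |P| * L` bits. -/
abbrev Library (m : ℕ) (P : Type) (L : ℕ) : Type := Fin m → P → Fin L → ZMod 2

/-- Placement and encoding of a D2D caching scheme for `n` users. User `u` caches the packets
`cached u` (a pair `(i, j)` stands for packet `j` of file `i`). For the demand vector `f`, it
transmits one bit for each element of `Msg u`, as a function of its own cache content and `f`. -/
structure D2DScheme (n m : ℕ) (P : Type) (L : ℕ) where
  cached : Fin n → Finset (Fin m × P)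
  Msg : Fin n → Type
  msgFintype : ∀ u, Fintype (Msg u)
  encode : ∀ u, (cached u → Fin L → ZMod 2) → (Fin n → Fin m) → Msg u → ZMod 2

namespace D2DScheme

variable {n m : ℕ} {P : Type} {L : ℕ}

/-- The cache content of user `u`. -/
def cacheContent (S : D2DScheme n m P L) (u : Fin n) (W : Library m P L) :
    S.cached u → Fin L → ZMod 2 :=
  fun x => W x.1.1 x.1.2

/-- The message transmitted by user `u`. -/
def message (S : D2DScheme n m P L) (u : Fin n) (W : Library m P L) (f : Fin n → Fin m) :
    S.Msg u → ZMod 2 :=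
  S.encode u (S.cacheContent u W) f

/-- Decoding functions: user `u` computes an estimate of a file from the messages of the users in
`D u`, its own cache content and the demand vector. -/
def Decoder (S : D2DScheme n m P L) (D : Fin n → Set (Fin n)) : Type :=
  ∀ u : Fin n, (∀ v : D u, S.Msg v → ZMod 2) → (S.cached u → Fin L → ZMod 2) →
    (Fin n → Fin m) → P → Fin L → ZMod 2

/-- The estimate of user `u`. -/
def estimate (S : D2DScheme n m P L) {D : Fin n → Set (Fin n)} (dec : S.Decoder D)
    (u : Fin n) (W : Library m P L) (f : Fin n → Fin m) : P → Fin L → ZMod 2 :=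
  dec u (fun v => S.message v W f) (S.cacheContent u W) f

/-- The worst-case error probability, over all demand vectors and users, when the library is
uniformly distributed (independent files of `F` uniform bits). -/
def errorProb (S : D2DScheme n m P L) {D : Fin n → Set (Fin n)} (dec : S.Decoder D) : ℝ :=
  ⨆ f : Fin n → Fin m, ⨆ u : Fin n,
    (Nat.card {W : Library m P L // S.estimate dec u W f ≠ W (f u)} : ℝ) /
      Nat.card (Library m P L)

/-- The transmission rate: the total number of transmitted bits divided by the file size. -/
def rate (S : D2DScheme n m P L) : ℝ :=
  (∑ u, (Nat.card (S.Msg u) : ℝ)) / (Nat.card P * L : ℝ)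

end D2DScheme

/-- The family `S` of schemes (indexed by the number `L` of bits per packet, so by the file size
`F = |P| * L → ∞`) achieves the cache-rate pair `(M, R)` on the network: each user caches at most
`M * |P|` packets, that is `M * F` bits, `limsup R^(F) ≤ R`, and, with some feasible transmission
policy, for every `ε > 0` there are decoding functions with `limsup P_e^(F) ≤ ε`. -/
def Achieves {n m : ℕ} {P : Type} (net : D2DNetwork n) (S : ∀ L : ℕ, D2DScheme n m P L)
    (M R : ℝ) : Prop :=
  (∀ L u, (((S L).cached u).card : ℝ) ≤ M * Nat.card P) ∧
  (∀ η > 0, ∀ᶠ L in atTop, (S L).rate ≤ R + η) ∧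
  ∃ A : ℕ → Set (Fin n × Fin n), (∀ s, net.Feasible (A s)) ∧
    ∀ ε > 0, ∃ dec : ∀ L, (S L).Decoder (receivedFrom A),
      ∀ η > 0, ∀ᶠ L in atTop, (S L).errorProb (dec L) ≤ ε + η

/-! ### Ruzsa-Szemerédi graphs -/

/-- An induced matching of size `γ` in `G`, with its edges listed: edge number `i` joins
`node (i, false)` and `node (i, true)`, all these `2 γ` vertices are distinct, and `G` has no other
edge between them. -/
structure InducedMatching {V : Type} (G : SimpleGraph V) (γ : ℕ) where
  node : Fin γ × Bool → V
  node_injective : Function.Injective node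
  adj_iff : ∀ p q, G.Adj (node p) (node q) ↔ p.1 = q.1 ∧ p.2 ≠ q.2

/-- The edge set of an induced matching. -/
def InducedMatching.edges {V : Type} {G : SimpleGraph V} {γ : ℕ} (μ : InducedMatching G γ) :
    Set (Sym2 V) :=
  Set.range fun i => s(μ.node (i, false), μ.node (i, true))

/-- `G` is a `(γ, τ)`-Ruzsa-Szemerédi graph: its edge set is the union of `τ` pairwise disjoint
induced matchings, each of size `γ`. -/
structure RSDecomposition {V : Type} (G : SimpleGraph V) (γ τ : ℕ) where
  matching : Fin τ → InducedMatching G γ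
  disjoint : ∀ i j, i ≠ j → Disjoint (matching i).edges (matching j).edges
  cover : ⋃ i, (matching i).edges = G.edgeSet

/-! ### The Ruzsa-Szemerédi caching scheme -/

/-- The `2 γ - 1` nodes of a matching other than the node `p`, numbered. -/
def senderLabel {γ : ℕ} (p : Fin γ × Bool) : {q : Fin γ × Bool // q ≠ p} ≃ Fin (2 * γ - 1) :=
  Fintype.equivFinOfCardEq (by
    simp [Fintype.card_subtype_compl, mul_comm])

/-- The packet labels of the scheme: each vertex represents `2 γ - 1` packets, so that there are
`K = n (2 γ - 1)` packets per file. -/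
abbrev RSPacket (n γ : ℕ) : Type := Fin n × Fin (2 * γ - 1)

open Classical in
/-- The placement of the scheme: user `u` caches, for every file, the packets of the vertices that
are not adjacent to `u`, including `u` itself. -/
def rsCached {n : ℕ} (G : SimpleGraph (Fin n)) (γ m : ℕ) (u : Fin n) :
    Finset (Fin m × RSPacket n γ) :=
  Finset.univ.filter fun x => ¬ G.Adj u x.2.1

open Classical in
/-- The caching scheme of a Ruzsa-Szemerédi graph on the set of users. In each matching, every node
`q` transmits the sum (XOR) of `2 γ - 1` packets, one for each other node `p` of the matching: a
packet, of the file requested by `p`, that is represented by the vertex matched to `p`. The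
different senders `q` use different packets for `p`. (All these packets are in the cache of the
sender, so the value `0` after `hj` is never used.) -/
def rsScheme {n γ τ : ℕ} {G : SimpleGraph (Fin n)} (𝓜 : RSDecomposition G γ τ) (m L : ℕ) :
    D2DScheme n m (RSPacket n γ) L where
  cached u := rsCached G γ m u
  Msg u := {x : Fin τ × (Fin γ × Bool) // (𝓜.matching x.1).node x.2 = u} × Fin L
  msgFintype _ := inferInstance
  encode u Z f x :=
    let node := (𝓜.matching x.1.1.1).node
    let q := x.1.1.2
    ∑ p : Fin γ × Bool,
      if hq : q ≠ p then
        let j : Fin m × RSPacket n γ :=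
          (f (node p), node (p.1, !p.2), senderLabel p ⟨q, hq⟩)
        if hj : j ∈ rsCached G γ m u then Z ⟨j, hj⟩ x.2 else 0
      else 0

/-- The exponent `δ = 2 ln 10.5 / ln Λ`. -/
def rsDelta (Λ : ℕ) : ℝ := 2 * Real.log 10.5 / Real.log Λ

end

/-! The graph is a Cayley graph on the torus `(ZMod Λ)^z`. In high dimension almost all vectors have
squared norm within `z` of the mean `μ`. The connection set consists of such typical vectors, one
from each pair `±v`, so the graph is nearly complete. An edge is described by its difference `v` and
its rounded midpoint. Two edges with the same midpoint, whose differences `v`, `w` have the same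
coordinate parities, are the diagonals of a parallelogram. By the parallelogram law
(`torusSq_edgeEnd_add_le`), the squared distances from an end of `v` to the two ends of `w` add up
to at most `(|v|² + |w|²)/2 ≤ μ + z`. If one of these distances is long enough to be an edge (`≥ μ -
z`), the other is at most `2 z`. A ball of that squared radius has at most `16 ^ z` points
(`card_torusSq_le`), so each difference conflicts with at most `4 * 16 ^ z` others of its parity
class. A greedy choice then packs nearly all differences into conflict-free families of size `γ`,
and each translate of a family is an induced matching.

The non-neighbours of a vertex come from atypical vectors (an exponential-moment bound,
`card_atypical_le`), from vectors `v = -v`, and from differences left over by the packing; their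
number governs the cache size. Families use disjoint sets of differences, so `k` of them satisfy `2
k γ ≤ n`. With `τ = n k` and `2 γ - 1 ≥ n ^ (1 - δ)` this gives rate at most `n ^ δ`.

Decoding has zero error. Since `r ≥ √2` is at least the diameter of the square, users can transmit
in turn and be heard by everyone. In every XOR sent by another node of a matching, a node caches all
terms except the one meant for it (`requested_file_eq`). -/

/-! ### Ruzsa-Szemerédi decompositions from explicit matchings -/

/-- A graph on a type with `n` elements whose edges are partitioned into the induced matchings
`node i` gives a Ruzsa-Szemerédi graph on `Fin n`. -/
theorem exists_rsDecomposition_of_node {V ι : Type} [Fintype V] [Fintype ι] {n γ : ℕ}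
    (hn : Fintype.card V = n) (G : SimpleGraph V) (node : ι → Fin γ × Bool → V)
    (hinj : ∀ i, Function.Injective (node i))
    (hadj : ∀ i p q, G.Adj (node i p) (node i q) ↔ p.1 = q.1 ∧ p.2 ≠ q.2)
    (hdisj : ∀ i i' j j', s(node i (j, false), node i (j, true)) =
      s(node i' (j', false), node i' (j', true)) → i = i')
    (hcover : ∀ x y, G.Adj x y → ∃ i j, s(node i (j, false), node i (j, true)) = s(x, y)) :
    ∃ (G' : SimpleGraph (Fin n)) (_ : G' ≃g G), Nonempty (RSDecomposition G' γ (Fintype.card ι)) := by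
  classical
  let φ : Fin n ≃ V := (Fintype.equivFinOfCardEq hn).symm
  let ψ : Fin (Fintype.card ι) ≃ ι := (Fintype.equivFin ι).symm
  let G' : SimpleGraph (Fin n) := G.comap φ
  have hG' : ∀ u v, G'.Adj u v ↔ G.Adj (φ u) (φ v) := fun u v => Iff.rfl
  let μ : Fin (Fintype.card ι) → InducedMatching G' γ := fun i =>
    { node := fun p => φ.symm (node (ψ i) p)
      node_injective := φ.symm.injective.comp (hinj _)
      adj_iff := fun p q => by
        rw [hG', φ.apply_symm_apply, φ.apply_symm_apply]; exact hadj _ p q }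
  have hedge : ∀ i j, s((μ i).node (j, false), (μ i).node (j, true)) =
      Sym2.map φ.symm s(node (ψ i) (j, false), node (ψ i) (j, true)) := fun i j => rfl
  refine ⟨G', ⟨φ, Iff.rfl⟩, ⟨⟨μ, ?_, ?_⟩⟩⟩
  · intro i i' hne
    rw [Set.disjoint_left]
    rintro _ ⟨j, rfl⟩ ⟨j', h⟩
    simp only [hedge] at h
    exact hne (ψ.injective (hdisj _ _ _ _ (Sym2.map.injective φ.symm.injective h.symm)))
  · ext x
    induction x using Sym2.ind with
    | _ u v =>
      rw [Set.mem_iUnion, SimpleGraph.mem_edgeSet]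
      constructor
      · rintro ⟨i, j, h⟩
        rw [← SimpleGraph.mem_edgeSet, ← h]
        exact ((μ i).adj_iff _ _).2 ⟨rfl, by simp⟩
      · intro h
        obtain ⟨i, j, hij⟩ := hcover _ _ ((hG' u v).1 h)
        refine ⟨ψ.symm i, j, ?_⟩
        simp only [hedge, Equiv.apply_symm_apply]
        rw [hij]
        simp

/-! ### Cayley graphs whose edges are grouped by midpoint and difference. -/

section Cayley

variable {Γ : Type} [AddCommGroup Γ]

/-- The two ends of an edge with difference `e`, placed relative to its (rounded) midpoint. -/
def edgeEnd (a : Γ → Γ) (e : Γ) (b : Bool) : Γ := cond b e 0 - a e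

/-- The Cayley graph with the connection set `± S`. -/
def symCayley (S : Set Γ) (h0 : (0 : Γ) ∉ S) : SimpleGraph Γ where
  Adj x y := y - x ∈ S ∨ x - y ∈ S
  symm := ⟨fun _ _ h => h.symm⟩
  loopless := ⟨fun x h => by simp [h0] at h⟩

/-- Translates of families of differences with mutually distant ends form a Ruzsa-Szemerédi
decomposition of a Cayley graph. -/
theorem exists_rsDecomposition_cayley [Fintype Γ] {ι : Type} [Fintype ι] {n γ : ℕ}
    (hn : Fintype.card Γ = n) (a : Γ → Γ) (F : ι × Fin γ → Γ) (hF : Function.Injective F)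
    (hneg : ∀ p q, F p ≠ -F q) (h0 : (0 : Γ) ∉ Set.range F)
    (hsep : ∀ i j j' b b', j ≠ j' →
      edgeEnd a (F (i, j)) b ≠ edgeEnd a (F (i, j')) b' ∧
      edgeEnd a (F (i, j)) b - edgeEnd a (F (i, j')) b' ∉ Set.range F) :
    ∃ (G' : SimpleGraph (Fin n)) (_ : G' ≃g symCayley (Set.range F) h0),
      Nonempty (RSDecomposition G' γ (n * Fintype.card ι)) := by
  subst hn
  rw [← Fintype.card_prod]
  -- A matching is indexed by a centre `c` and a family `i`: it consists of the edges with rounded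
  -- midpoint `c` and differences in that family.
  refine exists_rsDecomposition_of_node rfl _
    (fun (i : Γ × ι) (p : Fin γ × Bool) => i.1 + edgeEnd a (F (i.2, p.1)) p.2) ?_ ?_ ?_ ?_
  · rintro ⟨c, i⟩ ⟨j, b⟩ ⟨j', b'⟩ h
    simp only [add_right_inj] at h
    by_cases hj : j = j'
    · subst hj
      have : F (i, j) ≠ 0 := fun h => h0 ⟨_, h⟩
      simp only [edgeEnd, sub_left_inj] at h
      cases b <;> cases b' <;> simp_all [eq_comm]
    · exact absurd h (hsep i j j' b b' hj).1
  · rintro ⟨c, i⟩ ⟨j, b⟩ ⟨j', b'⟩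
    simp only [symCayley, add_sub_add_left_eq_sub]
    by_cases hj : j = j'
    · subst hj
      have h1 : F (i, j) ∈ Set.range F := ⟨_, rfl⟩
      cases b <;> cases b' <;> simp [edgeEnd, h0, -Set.mem_range, h1]
    · simp only [hj, false_and, iff_false, not_or]
      exact ⟨(hsep i j' j b' b (Ne.symm hj)).2, (hsep i j j' b b' hj).2⟩
  · rintro ⟨c, i⟩ ⟨c', i'⟩ j j' h
    simp only [edgeEnd, cond_false, cond_true, Sym2.eq_iff] at h
    rcases h with ⟨h1, h2⟩ | ⟨h1, h2⟩
    · have he : F (i, j) = F (i', j') := by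
        have := congrArg₂ (· - ·) h2 h1
        simpa using this
      obtain ⟨rfl, rfl⟩ := Prod.mk.inj (hF he)
      simpa using h1
    -- A coincidence with opposite orientations would make one difference the negative of another.
    · exfalso
      apply hneg (i, j) (i', j')
      have := congrArg₂ (· - ·) h2 h1
      rw [add_sub_add_left_eq_sub, add_sub_add_left_eq_sub, sub_sub_sub_cancel_right,
        sub_sub_sub_cancel_right, sub_zero, zero_sub] at this
      exact this
  · intro x y h
    rcases h with ⟨⟨i, j⟩, h⟩ | ⟨⟨i, j⟩, h⟩
    · refine ⟨(x + a (F (i, j)), i), j, ?_⟩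
      simp only [edgeEnd, cond_false, cond_true]
      rw [Sym2.eq_iff]; left
      constructor
      · abel
      · rw [h]; abel
    · refine ⟨(y + a (F (i, j)), i), j, ?_⟩
      simp only [edgeEnd, cond_false, cond_true]
      rw [Sym2.eq_iff]; right
      constructor
      · abel
      · rw [h]; abel

open Classical in
/-- The number of non-neighbours in a Cayley graph. -/
theorem card_not_adj_symCayley [Fintype Γ] {κ : Type} [Fintype κ] (F : κ → Γ)
    (hF : Function.Injective F) (hneg : ∀ p q, F p ≠ -F q) (h0 : (0 : Γ) ∉ Set.range F) (x : Γ) :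
    (Finset.univ.filter fun y => ¬ (symCayley (Set.range F) h0).Adj x y).card +
      2 * Fintype.card κ = Fintype.card Γ := by
  have h := Finset.card_filter_add_card_filter_not (s := (Finset.univ : Finset Γ))
    (fun y => (symCayley (Set.range F) h0).Adj x y)
  have hN : (Finset.univ.filter fun y => (symCayley (Set.range F) h0).Adj x y) =
      (Finset.univ.image fun p : κ => x + F p) ∪ (Finset.univ.image fun p : κ => x - F p) := by
    ext y
    simp only [symCayley, Set.mem_range, Finset.mem_filter, Finset.mem_univ, true_and,
      Finset.mem_union, Finset.mem_image]
    refine or_congr (exists_congr fun p => ?_) (exists_congr fun p => ?_)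
    · rw [eq_sub_iff_add_eq']
    · rw [eq_sub_iff_add_eq, sub_eq_iff_eq_add, add_comm, eq_comm]
  have hd : Disjoint (Finset.univ.image fun p : κ => x + F p)
      (Finset.univ.image fun p : κ => x - F p) := by
    rw [Finset.disjoint_left]
    intro y hy hy'
    simp only [Finset.mem_image, Finset.mem_univ, true_and] at hy hy'
    obtain ⟨p, rfl⟩ := hy
    obtain ⟨q, hq⟩ := hy'
    refine hneg p q ?_
    rw [sub_eq_add_neg, add_right_inj] at hq
    exact hq.symm
  rw [hN, Finset.card_union_of_disjoint hd,
    Finset.card_image_of_injective _ (fun p q h => hF (by simpa using h)),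
    Finset.card_image_of_injective _ (fun p q h => hF (by simpa using h)), Finset.card_univ,
    Finset.card_univ] at h
  omega

end Cayley

/-! ### Greedy choice of independent families -/

open Classical in
/-- A large set in which each element conflicts with at most `Δ` elements contains `γ` elements
without conflicts. -/
theorem exists_independent_family {α : Type} (conf : α → α → Prop) (hsymm : ∀ x y, conf x y → conf y x)
    (Δ : ℕ) :
    ∀ (γ : ℕ) (U : Finset α), (∀ x ∈ U, (U.filter (conf x)).card ≤ Δ) → (Δ + 1) * γ ≤ U.card →
      ∃ f : Fin γ → α, Function.Injective f ∧ (∀ j, f j ∈ U) ∧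
        ∀ j j', j ≠ j' → ¬ conf (f j) (f j') := by
  intro γ
  induction γ with
  | zero => exact fun U _ _ => ⟨Fin.elim0, fun j => j.elim0, fun j => j.elim0, fun j => j.elim0⟩
  | succ γ ih =>
    intro U hU hcard
    have hpos : 0 < U.card := lt_of_lt_of_le (by positivity) hcard
    obtain ⟨x, hx⟩ := Finset.card_pos.1 hpos
    -- Choosing `x` costs at most `Δ + 1` elements: its conflicts and `x` itself, erased separately
    -- because `conf` need not be reflexive.
    set U' := (U.erase x).filter fun y => ¬ conf x y with hU'
    have hsub : U' ⊆ U := (Finset.filter_subset _ _).trans (Finset.erase_subset _ _)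
    have hc : U.card ≤ U'.card + (Δ + 1) := by
      have h1 : ((U.erase x).filter (conf x)).card + U'.card = (U.erase x).card := by
        rw [hU']
        convert Finset.card_filter_add_card_filter_not (s := U.erase x) (conf x)
      have h2 : ((U.erase x).filter (conf x)).card ≤ Δ :=
        (Finset.card_le_card (Finset.filter_subset_filter _ (Finset.erase_subset _ _))).trans
          (hU x hx)
      have h3 := Finset.card_erase_of_mem hx
      omega
    obtain ⟨f, hf, hfU, hfc⟩ := ih U'
      (fun y hy => (Finset.card_le_card (Finset.filter_subset_filter _ hsub)).trans
        (hU y (hsub hy))) (by rw [mul_add, mul_one] at hcard; omega)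
    have hx' : ∀ j, f j ≠ x ∧ ¬ conf x (f j) := fun j => by
      have := hfU j
      simp only [hU', Finset.mem_filter, Finset.mem_erase] at this
      exact ⟨this.1.1, this.2⟩
    refine ⟨Fin.cons x f, ?_, ?_, ?_⟩
    · rw [Fin.cons_injective_iff]
      exact ⟨fun ⟨j, hj⟩ => (hx' j).1 hj, hf⟩
    · intro j
      refine Fin.cases hx (fun j => ?_) j
      exact hsub (hfU j)
    · intro j j'
      refine Fin.cases (Fin.cases (by simp) (fun j' _ => ?_) j')
        (fun j => Fin.cases (fun _ => ?_) (fun j' hne => ?_) j') j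
      · exact (hx' j').2
      · exact fun h => (hx' j).2 (hsymm _ _ h)
      · simpa using hfc j j' (fun h => hne (by rw [h]))

/-- If every subset of `U` with at least `N` elements contains a family of `γ` elements with the
property `P`, then all but fewer than `N` elements of `U` are covered by disjoint such families. -/
theorem exists_disjoint_families {α : Type} {γ : ℕ} (hγ : 1 ≤ γ) (P : (Fin γ → α) → Prop) (N : ℕ) :
    ∀ (k : ℕ) (U : Finset α), U.card ≤ k →
      (∀ U' ⊆ U, N ≤ U'.card → ∃ f : Fin γ → α, Function.Injective f ∧ (∀ j, f j ∈ U') ∧ P f) →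
      ∃ (ι : Type) (_ : Fintype ι) (F : ι × Fin γ → α), Function.Injective F ∧ (∀ p, F p ∈ U) ∧
        (∀ i, P fun j => F (i, j)) ∧ U.card < Fintype.card (ι × Fin γ) + max N 1 := by
  classical
  intro k
  induction k with
  | zero =>
    -- For `U` empty and `N = 0` the strict bound would fail with `N` alone; hence `max N 1`.
    intro U hU _
    exact ⟨Empty, inferInstance, fun p => p.1.elim, fun p => p.1.elim, fun p => p.1.elim,
      fun i => i.elim, by omega⟩
  | succ k ih =>
    intro U hU h
    by_cases hN : U.card < N
    · exact ⟨Empty, inferInstance, fun p => p.1.elim, fun p => p.1.elim, fun p => p.1.elim,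
        fun i => i.elim, by omega⟩
    obtain ⟨f, hf, hfU, hP⟩ := h U subset_rfl (by omega)
    have himg : (Finset.univ.image f) ⊆ U := by
      intro x hx
      simp only [Finset.mem_image, Finset.mem_univ, true_and] at hx
      obtain ⟨j, rfl⟩ := hx
      exact hfU j
    have hc : (U \ Finset.univ.image f).card + γ = U.card := by
      rw [Finset.card_sdiff_of_subset himg, Finset.card_image_of_injective _ hf]
      have := Finset.card_le_card himg
      rw [Finset.card_image_of_injective _ hf] at this
      simp at *
      omega
    obtain ⟨ι, _, F, hF, hFU, hFP, hFc⟩ := ih (U \ Finset.univ.image f) (by omega)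
      (fun U' hU' => h U' (hU'.trans Finset.sdiff_subset))
    have hFf : ∀ p j, F p ≠ f j := fun p j hpj => by
      have := hFU p
      rw [hpj] at this
      simp at this
    refine ⟨Option ι, inferInstance, fun p => p.1.elim (f p.2) fun i => F (i, p.2), ?_, ?_, ?_, ?_⟩
    · rintro ⟨_ | i, j⟩ ⟨_ | i', j'⟩ h
      · simpa using hf h
      · exact absurd h.symm (hFf _ _)
      · exact absurd h (hFf _ _)
      · simpa using hF h
    · rintro ⟨_ | i, j⟩
      · exact hfU j
      · exact Finset.sdiff_subset (hFU _)
    · rintro (_ | i)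
      · exact hP
      · exact hFP i
    · simp only [Fintype.card_prod, Fintype.card_option, Fintype.card_fin] at hFc ⊢
      rw [add_mul]
      omega

/-! ### The squared norm on the discrete torus -/

section Torus

variable {d q : ℕ}

/-- The square of the Euclidean distance to `0` on the discrete torus. -/
def torusSq (v : Fin d → ZMod q) : ℤ := ∑ i, (v i).valMinAbs ^ 2

/-- Half of the shortest lift of a torus element, rounded down. -/
def torusHalf (v : Fin d → ZMod q) : Fin d → ZMod q := fun i => ((v i).valMinAbs / 2 : ℤ)

/-- The parities of the coordinates of the shortest lift. -/
def torusParity (v : Fin d → ZMod q) : Fin d → Bool := fun i => decide ((v i).valMinAbs % 2 = 1)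

theorem torusParity_eq {v w : Fin d → ZMod q} (h : torusParity v = torusParity w) (i : Fin d) :
    (v i).valMinAbs % 2 = (w i).valMinAbs % 2 := by
  have := congrFun h i
  simp only [torusParity, decide_eq_decide] at this
  omega

/-- The lift `valMinAbs` is shortest in its residue class, so identities between integer lifts
become upper bounds on the torus. -/
theorem sq_valMinAbs_intCast_le [NeZero q] (k : ℤ) : ((k : ZMod q)).valMinAbs ^ 2 ≤ k ^ 2 := by
  rw [← Int.natAbs_le_iff_sq_le]
  exact ZMod.natAbs_min_of_le_div_two q _ _ (by simp) (ZMod.natAbs_valMinAbs_le _)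

theorem edgeEnd_torusHalf (v : Fin d → ZMod q) (b : Bool) (i : Fin d) :
    edgeEnd torusHalf v b i =
      ((cond b ((v i).valMinAbs) 0 - (v i).valMinAbs / 2 : ℤ) : ZMod q) := by
  cases b <;> simp [edgeEnd, torusHalf]

/-- The parallelogram law for two differences with the same parities. -/
theorem torusSq_edgeEnd_add_le [NeZero q] {v w : Fin d → ZMod q}
    (h : torusParity v = torusParity w) (b c : Bool) :
    2 * (torusSq (edgeEnd torusHalf v b - edgeEnd torusHalf w c) +
      torusSq (edgeEnd torusHalf v b - edgeEnd torusHalf w (!c))) ≤ torusSq v + torusSq w := by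
  simp only [torusSq, ← Finset.sum_add_distrib, Finset.mul_sum]
  refine Finset.sum_le_sum fun i _ => ?_
  simp only [Pi.sub_apply, edgeEnd_torusHalf, ← Int.cast_sub]
  have hp := torusParity_eq h i
  generalize (v i).valMinAbs = k at *
  generalize (w i).valMinAbs = l at *
  refine (mul_le_mul_of_nonneg_left (add_le_add (sq_valMinAbs_intCast_le _)
    (sq_valMinAbs_intCast_le _)) (by norm_num)).trans ?_
  -- With `k = 2 s + o` and `l = 2 t + o`, the ends are `-s, s + o` and `-t, t + o`. The common
  -- parity `o` makes the parallelogram law exact despite the rounding.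
  obtain ⟨s, hs⟩ : ∃ s, s = k / 2 := ⟨_, rfl⟩
  obtain ⟨t, ht⟩ : ∃ t, t = l / 2 := ⟨_, rfl⟩
  rw [← hs, ← ht]
  have hk : k = 2 * s + k % 2 := by omega
  have hl : l = 2 * t + k % 2 := by omega
  generalize k % 2 = o at *
  subst hk hl
  cases b <;> cases c <;> simp only [cond_true, cond_false, Bool.not_true, Bool.not_false] <;>
    apply le_of_eq <;> ring

/-- An end determines the rounded half modulo `q`, and twice that half plus the known parity is the
vector. No division by 2 is needed, so `q` may be even. -/
theorem edgeEnd_torusHalf_injOn (b : Bool) {v w : Fin d → ZMod q}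
    (hp : torusParity v = torusParity w)
    (h : edgeEnd torusHalf v b = edgeEnd torusHalf w b) : v = w := by
  funext i
  have h1 := congrFun h i
  rw [edgeEnd_torusHalf, edgeEnd_torusHalf] at h1
  have hp := torusParity_eq hp i
  rw [← ZMod.coe_valMinAbs (v i), ← ZMod.coe_valMinAbs (w i)]
  generalize (v i).valMinAbs = k at *
  generalize (w i).valMinAbs = l at *
  have hk : k = k / 2 + k / 2 + k % 2 := by omega
  have hl : l = l / 2 + l / 2 + k % 2 := by omega
  have h2 : ((k / 2 : ℤ) : ZMod q) = (l / 2 : ℤ) := by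
    cases b
    · simpa using h1
    · have e1 : k - k / 2 = k / 2 + k % 2 := by omega
      have e2 : l - l / 2 = l / 2 + k % 2 := by omega
      simp only [cond_true, e1, e2, Int.cast_add, add_left_inj] at h1
      exact h1
  rw [hk, hl]
  simp only [Int.cast_add] at h2 ⊢
  rw [h2]

theorem torusSq_neg (v : Fin d → ZMod q) : torusSq (-v) = torusSq v := by
  refine Finset.sum_congr rfl fun i _ => ?_
  rw [← Int.natAbs_sq, ← Int.natAbs_sq (v i).valMinAbs, Pi.neg_apply, ZMod.natAbs_valMinAbs_neg]

theorem torusSq_zero : torusSq (0 : Fin d → ZMod q) = 0 := by simp [torusSq]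

/-- The ends of two typical differences with the same parities that are equal or differ by an
element of norm at least `s` force two ends to be close. -/
theorem exists_torusSq_edgeEnd_le [NeZero q] {v w : Fin d → ZMod q} {s t : ℝ} {b c : Bool}
    (h : torusParity v = torusParity w) (hs : 0 ≤ t - s) (hv : torusSq v ≤ t) (hw : torusSq w ≤ t)
    (hvw : edgeEnd torusHalf v b = edgeEnd torusHalf w c ∨
      s ≤ torusSq (edgeEnd torusHalf v b - edgeEnd torusHalf w c)) :
    ∃ c', torusSq (edgeEnd torusHalf v b - edgeEnd torusHalf w c') ≤ t - s := by
  rcases hvw with hvw | hvw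
  · refine ⟨c, ?_⟩
    rw [hvw, sub_self, torusSq_zero]
    simpa using hs
  · refine ⟨!c, ?_⟩
    have := torusSq_edgeEnd_add_le h b c
    have : (2 * (torusSq (edgeEnd torusHalf v b - edgeEnd torusHalf w c) +
      torusSq (edgeEnd torusHalf v b - edgeEnd torusHalf w (!c))) : ℝ) ≤ torusSq v + torusSq w := by
      exact_mod_cast this
    linarith

/-! ### Counting in the torus -/

theorem card_fiber_natAbs_valMinAbs_le [NeZero q] (j : ℕ) :
    (Finset.univ.filter fun t : ZMod q => t.valMinAbs.natAbs = j).card ≤ 2 := by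
  classical
  calc _ ≤ ({(j : ZMod q), -(j : ZMod q)} : Finset (ZMod q)).card := by
        refine Finset.card_le_card fun t ht => ?_
        simp only [Finset.mem_filter, Finset.mem_univ, true_and] at ht
        rw [Finset.mem_insert, Finset.mem_singleton, ← ZMod.coe_valMinAbs t]
        rcases Int.natAbs_eq t.valMinAbs with h | h <;> rw [h, ht] <;> simp
    _ ≤ 2 := Finset.card_le_two

theorem sum_half_pow_sq_valMinAbs_le [NeZero q] :
    ∑ t : ZMod q, (1 / 2 : ℝ) ^ (t.valMinAbs.natAbs ^ 2) ≤ 4 := by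
  classical
  calc ∑ t : ZMod q, (1 / 2 : ℝ) ^ (t.valMinAbs.natAbs ^ 2)
      ≤ ∑ t : ZMod q, (1 / 2 : ℝ) ^ t.valMinAbs.natAbs :=
        Finset.sum_le_sum fun t _ => pow_le_pow_of_le_one (by norm_num) (by norm_num)
          (Nat.le_self_pow (by norm_num) _)
    _ = ∑ j ∈ Finset.range (q + 1), ∑ t ∈ Finset.univ.filter
          (fun t : ZMod q => t.valMinAbs.natAbs = j), (1 / 2 : ℝ) ^ t.valMinAbs.natAbs :=
        (Finset.sum_fiberwise_of_maps_to (fun t _ => by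
          have := ZMod.natAbs_valMinAbs_le t
          simp only [Finset.mem_range]; omega) _).symm
    _ ≤ ∑ j ∈ Finset.range (q + 1), 2 * (1 / 2 : ℝ) ^ j := by
        refine Finset.sum_le_sum fun j _ => ?_
        rw [Finset.sum_congr rfl (g := fun _ => (1 / 2 : ℝ) ^ j) (fun t ht => by
          rw [(Finset.mem_filter.1 ht).2]), Finset.sum_const, nsmul_eq_mul]
        have := card_fiber_natAbs_valMinAbs_le (q := q) j
        gcongr
        exact_mod_cast this
    _ ≤ 4 := by
        rw [← Finset.mul_sum, geom_sum_eq (by norm_num)]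
        have h : (0 : ℝ) < (1 / 2) ^ (q + 1) := by positivity
        generalize (1 / 2 : ℝ) ^ (q + 1) = x at *
        have : (x - 1) / (1 / 2 - 1) = 2 * (1 - x) := by ring
        linarith

/-- A ball of squared radius `2 d` in the torus has at most `16 ^ d` elements. -/
theorem card_torusSq_le [NeZero q] :
    (Finset.univ.filter fun v : Fin d → ZMod q => torusSq v ≤ 2 * d).card ≤ 16 ^ d := by
  have h : ((Finset.univ.filter fun v : Fin d → ZMod q => torusSq v ≤ 2 * d).card : ℝ) ≤ 16 ^ d := by
    calc ((Finset.univ.filter fun v : Fin d → ZMod q => torusSq v ≤ 2 * d).card : ℝ)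
        = ∑ v ∈ Finset.univ.filter fun v : Fin d → ZMod q => torusSq v ≤ 2 * d, (1 : ℝ) := by simp
      -- On the ball the weight `4 ^ d * 2 ^ (-|v|²)` is at least 1. It is a product over
      -- coordinates, so its sum over the whole torus factorizes.
      _ ≤ ∑ v ∈ Finset.univ.filter fun v : Fin d → ZMod q => torusSq v ≤ 2 * d,
            (4 : ℝ) ^ d * ∏ i, (1 / 2 : ℝ) ^ ((v i).valMinAbs.natAbs ^ 2) := by
          refine Finset.sum_le_sum fun v hv => ?_
          have hv := (Finset.mem_filter.1 hv).2
          rw [Finset.prod_pow_eq_pow_sum]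
          have : (∑ i, (v i).valMinAbs.natAbs ^ 2) ≤ 2 * d := by
            have e : ((∑ i, (v i).valMinAbs.natAbs ^ 2 : ℕ) : ℤ) = torusSq v := by
              simp [torusSq]
            rw [← e] at hv
            exact_mod_cast hv
          calc (1 : ℝ) = 4 ^ d * (1 / 2) ^ (2 * d) := by
                rw [pow_mul, ← mul_pow]; norm_num
            _ ≤ _ := by
                gcongr 4 ^ d * ?_
                exact pow_le_pow_of_le_one (by norm_num) (by norm_num) this
      _ ≤ ∑ v : Fin d → ZMod q, (4 : ℝ) ^ d * ∏ i, (1 / 2 : ℝ) ^ ((v i).valMinAbs.natAbs ^ 2) :=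
          Finset.sum_le_sum_of_subset_of_nonneg (Finset.filter_subset _ _)
            fun _ _ _ => by positivity
      _ = 4 ^ d * (∑ t : ZMod q, (1 / 2 : ℝ) ^ (t.valMinAbs.natAbs ^ 2)) ^ d := by
          rw [← Finset.mul_sum, Fintype.sum_pow]
      _ ≤ 4 ^ d * 4 ^ d := by
          gcongr
          exact sum_half_pow_sq_valMinAbs_le
      _ = 16 ^ d := by rw [← mul_pow]; norm_num
  exact_mod_cast h

/-- Each coordinate must be `0` or `q / 2`. -/
theorem card_eq_neg_le [NeZero q] :
    (Finset.univ.filter fun v : Fin d → ZMod q => v = -v).card ≤ 2 ^ d := by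
  classical
  have h2 : (Finset.univ.filter fun t : ZMod q => t = -t).card ≤ 2 := by
    calc _ ≤ ({0, ((q / 2 : ℕ) : ZMod q)} : Finset (ZMod q)).card := by
          refine Finset.card_le_card fun t ht => ?_
          simp only [Finset.mem_filter, Finset.mem_univ, true_and] at ht
          rw [Finset.mem_insert, Finset.mem_singleton]
          rcases (ZMod.neg_eq_self_iff t).1 ht.symm with h | h
          · exact Or.inl h
          · right
            rw [← ZMod.natCast_zmod_val t]
            congr 1
            omega
      _ ≤ 2 := Finset.card_le_two
  calc _ = (Fintype.piFinset fun _ : Fin d => Finset.univ.filter fun t : ZMod q => t = -t).card := by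
        congr 1
        ext v
        simp [Fintype.mem_piFinset, funext_iff]
    _ ≤ 2 ^ d := by
        rw [Fintype.card_piFinset_const]
        exact Nat.pow_le_pow_left h2 _

/-! ### Concentration -/

/-- An exponential-moment tail bound for the number of points of a finite product at which a sum of
centred bounded functions is large. -/
theorem card_le_sum_of_centred {α : Type} [Fintype α] (φ : α → ℝ) {B : ℝ} (hB : 1 ≤ B)
    (hφ : ∀ a, |φ a| ≤ B) (h0 : ∑ a, φ a = 0) :
    ((Finset.univ.filter fun v : Fin d → α => (d : ℝ) ≤ ∑ i, φ (v i)).card : ℝ) ≤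
      (Fintype.card α : ℝ) ^ d * Real.exp (-(d / (4 * B ^ 2))) := by
  have hB0 : 0 < B := by linarith
  -- This `l` minimizes the exponent `-l + l ^ 2 * B ^ 2`. It also keeps `|l * φ a| ≤ 1`, where `exp
  -- y ≤ 1 + y + y ^ 2` is available.
  set l : ℝ := 1 / (2 * B ^ 2) with hl
  have hl0 : 0 < l := by positivity
  have hlB : l * B ≤ 1 := by
    rw [hl, div_mul_eq_mul_div, div_le_one (by positivity)]
    nlinarith
  have hone : ∑ a, Real.exp (l * φ a) ≤ Fintype.card α * Real.exp (l ^ 2 * B ^ 2) := by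
    calc ∑ a, Real.exp (l * φ a) ≤ ∑ a, (1 + l * φ a + l ^ 2 * B ^ 2) := by
          refine Finset.sum_le_sum fun a _ => ?_
          have h1 : |l * φ a| ≤ l * B := by
            rw [abs_mul, abs_of_pos hl0]
            exact mul_le_mul_of_nonneg_left (hφ a) hl0.le
          have h2 := (abs_le.1 (Real.abs_exp_sub_one_sub_id_le (h1.trans hlB))).2
          have h3 : (l * φ a) ^ 2 ≤ (l * B) ^ 2 := sq_le_sq' (abs_le.1 h1).1 (abs_le.1 h1).2
          rw [← mul_pow]
          linarith
      _ = Fintype.card α * (1 + l ^ 2 * B ^ 2) := by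
          rw [Finset.sum_add_distrib, Finset.sum_add_distrib, ← Finset.mul_sum, h0]
          simp
          ring
      _ ≤ _ := by
          gcongr
          rw [add_comm]
          exact Real.add_one_le_exp _
  calc ((Finset.univ.filter fun v : Fin d → α => (d : ℝ) ≤ ∑ i, φ (v i)).card : ℝ)
      = ∑ v ∈ Finset.univ.filter fun v : Fin d → α => (d : ℝ) ≤ ∑ i, φ (v i), (1 : ℝ) := by simp
    _ ≤ ∑ v ∈ Finset.univ.filter fun v : Fin d → α => (d : ℝ) ≤ ∑ i, φ (v i),
          Real.exp (-(l * d)) * ∏ i, Real.exp (l * φ (v i)) := by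
        refine Finset.sum_le_sum fun v hv => ?_
        have hv := (Finset.mem_filter.1 hv).2
        rw [← Real.exp_sum, ← Real.exp_add, Real.one_le_exp_iff, ← Finset.mul_sum]
        nlinarith
    _ ≤ ∑ v : Fin d → α, Real.exp (-(l * d)) * ∏ i, Real.exp (l * φ (v i)) :=
        Finset.sum_le_sum_of_subset_of_nonneg (Finset.filter_subset _ _)
          fun _ _ _ => by positivity
    _ = Real.exp (-(l * d)) * (∑ a, Real.exp (l * φ a)) ^ d := by
        rw [← Finset.mul_sum, Fintype.sum_pow]
    _ ≤ Real.exp (-(l * d)) * (Fintype.card α * Real.exp (l ^ 2 * B ^ 2)) ^ d := by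
        gcongr
    _ = (Fintype.card α : ℝ) ^ d * Real.exp (-(d / (4 * B ^ 2))) := by
        rw [mul_pow, ← Real.exp_nat_mul, mul_left_comm, ← Real.exp_add]
        congr 2
        rw [hl]
        field_simp
        ring

/-- The average of the squared norm of one coordinate. -/
noncomputable def torusMean (q : ℕ) [NeZero q] : ℝ := (∑ t : ZMod q, (t.valMinAbs : ℝ) ^ 2) / q

/-- Squared coordinates and their mean lie in `[0, q ^ 2 / 4]`, so the tail bound applies with `B =
q ^ 2 / 4` to both signs of the deviation. -/
theorem card_atypical_le [NeZero q] (hq : 2 ≤ q) :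
    ((Finset.univ.filter fun v : Fin d → ZMod q =>
      (d : ℝ) ≤ |(torusSq v : ℝ) - d * torusMean q|).card : ℝ) ≤
      2 * ((q : ℝ) ^ d * Real.exp (-(4 * d / q ^ 4))) := by
  classical
  have hq2 : (2 : ℝ) ≤ q := by exact_mod_cast hq
  have hB : (1 : ℝ) ≤ (q : ℝ) ^ 2 / 4 := by nlinarith
  have hsq : ∀ t : ZMod q, (t.valMinAbs : ℝ) ^ 2 ≤ (q : ℝ) ^ 2 / 4 := fun t => by
    have h1 := ZMod.natAbs_valMinAbs_le t
    have h2 : 2 * t.valMinAbs.natAbs ≤ q := by omega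
    have h3 : (2 * t.valMinAbs.natAbs : ℝ) ≤ q := by exact_mod_cast h2
    have h4 : ((t.valMinAbs.natAbs : ℝ)) = |(t.valMinAbs : ℝ)| := by
      rw [Nat.cast_natAbs, Int.cast_abs]
    rw [h4] at h3
    rw [← sq_abs]
    nlinarith [abs_nonneg (t.valMinAbs : ℝ)]
  have hm0 : 0 ≤ torusMean q := by unfold torusMean; positivity
  have hm1 : torusMean q ≤ (q : ℝ) ^ 2 / 4 := by
    unfold torusMean
    rw [div_le_iff₀ (by linarith)]
    calc _ ≤ ∑ t : ZMod q, (q : ℝ) ^ 2 / 4 := Finset.sum_le_sum fun t _ => hsq t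
      _ = _ := by simp [ZMod.card]; ring
  have hcard : (Fintype.card (ZMod q) : ℝ) = q := by simp [ZMod.card]
  have hsum : ∑ t : ZMod q, ((t.valMinAbs : ℝ) ^ 2 - torusMean q) = 0 := by
    rw [Finset.sum_sub_distrib, Finset.sum_const, Finset.card_univ, nsmul_eq_mul, hcard, torusMean]
    field_simp
    ring
  have habs : ∀ t : ZMod q, |(t.valMinAbs : ℝ) ^ 2 - torusMean q| ≤ (q : ℝ) ^ 2 / 4 := fun t => by
    rw [abs_le]
    constructor <;> nlinarith [hsq t, sq_nonneg (t.valMinAbs : ℝ)]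
  have hsplit : ∀ v : Fin d → ZMod q, (torusSq v : ℝ) - d * torusMean q =
      ∑ i, (((v i).valMinAbs : ℝ) ^ 2 - torusMean q) := fun v => by
    simp [torusSq, Finset.sum_sub_distrib]
  have h1 := card_le_sum_of_centred (d := d)
    (fun t : ZMod q => (t.valMinAbs : ℝ) ^ 2 - torusMean q) hB habs hsum
  have h2 := card_le_sum_of_centred (d := d)
    (fun t : ZMod q => -((t.valMinAbs : ℝ) ^ 2 - torusMean q)) hB
    (fun t => by rw [abs_neg]; exact habs t) (by rw [Finset.sum_neg_distrib, hsum, neg_zero])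
  have he : -((d : ℝ) / (4 * ((q : ℝ) ^ 2 / 4) ^ 2)) = -(4 * d / q ^ 4) := by
    field_simp
  rw [hcard, he] at h1 h2
  have hU : (Finset.univ.filter fun v : Fin d → ZMod q =>
      (d : ℝ) ≤ |(torusSq v : ℝ) - d * torusMean q|) ⊆
      (Finset.univ.filter fun v : Fin d → ZMod q =>
        (d : ℝ) ≤ ∑ i, (((v i).valMinAbs : ℝ) ^ 2 - torusMean q)) ∪
      (Finset.univ.filter fun v : Fin d → ZMod q =>
        (d : ℝ) ≤ ∑ i, -(((v i).valMinAbs : ℝ) ^ 2 - torusMean q)) := by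
    intro v hv
    simp only [Finset.mem_union, Finset.mem_filter, Finset.mem_univ, true_and,
      Finset.sum_neg_distrib, ← hsplit] at hv ⊢
    exact le_abs.1 hv
  have h3 : ((Finset.univ.filter fun v : Fin d → ZMod q =>
      (d : ℝ) ≤ |(torusSq v : ℝ) - d * torusMean q|).card : ℝ) ≤ _ :=
    (Nat.cast_le.2 ((Finset.card_le_card hU).trans (Finset.card_union_le _ _)))
  rw [Nat.cast_add] at h3
  linarith

end Torus

/-! ### The Ruzsa-Szemerédi graph on the torus. -/

open Classical in
/-- A Ruzsa-Szemerédi graph with `q ^ d` vertices, all of large degree. -/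
theorem exists_rsDecomposition_torus {d q γ n : ℕ} [NeZero q] (hq : 2 ≤ q) (hn : n = q ^ d)
    (hγ : 1 ≤ γ) :
    ∃ (k : ℕ) (G : SimpleGraph (Fin n)), Nonempty (RSDecomposition G γ (n * k)) ∧
      2 * (k * γ) ≤ n ∧ ∀ u, ((Finset.univ.filter fun v => ¬ G.Adj u v).card : ℝ) ≤
        2 * ((q : ℝ) ^ d * Real.exp (-(4 * d / q ^ 4))) + 2 ^ d +
          2 * (2 ^ d * ((4 * 16 ^ d + 1) * γ)) := by
  let Γ := Fin d → ZMod q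
  set μ : ℝ := d * torusMean q
  -- An arbitrary enumeration, used only to select one vector from each pair `±v`.
  let ord := Fintype.equivFin Γ
  set A : Finset Γ := Finset.univ.filter fun v => |(torusSq v : ℝ) - μ| < d ∧ v ≠ -v with hA
  set A' : Finset Γ := A.filter fun v => ord v < ord (-v) with hA'
  have hAμ : ∀ v ∈ A', μ - d ≤ torusSq v ∧ (torusSq v : ℝ) ≤ μ + d ∧ v ≠ 0 := fun v hv => by
    simp only [hA', hA, Finset.mem_filter, Finset.mem_univ, true_and] at hv
    have := abs_lt.1 hv.1.1
    refine ⟨by linarith, by linarith, ?_⟩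
    rintro rfl
    simp at hv
  have hneg : ∀ v ∈ A', ∀ w ∈ A', v ≠ -w := fun v hv w hw h => by
    have h1 := (Finset.mem_filter.1 hv).2
    have h2 := (Finset.mem_filter.1 hw).2
    rw [h, neg_neg] at h1
    exact lt_asymm h1 h2
  have hAcard : A.card ≤ 2 * A'.card := by
    have hsub : A ⊆ A' ∪ A'.image (fun v => -v) := by
      intro v hv
      have hv' := hv
      simp only [hA, Finset.mem_filter, Finset.mem_univ, true_and] at hv'
      rcases lt_trichotomy (ord v) (ord (-v)) with h | h | h
      · exact Finset.mem_union_left _ (Finset.mem_filter.2 ⟨hv, h⟩)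
      · exact absurd (ord.injective h) hv'.2
      · refine Finset.mem_union_right _ (Finset.mem_image.2 ⟨-v, Finset.mem_filter.2 ⟨?_, ?_⟩, ?_⟩)
        · simp only [hA, Finset.mem_filter, Finset.mem_univ, true_and, neg_neg]
          refine ⟨?_, hv'.2.symm⟩
          rw [show torusSq (-v) = torusSq v from torusSq_neg v]
          exact hv'.1
        · rwa [neg_neg]
        · exact neg_neg v
    have := (Finset.card_le_card hsub).trans (Finset.card_union_le _ _)
    have := Finset.card_image_le (s := A') (f := fun v => -v)
    omega
  have hcompl : (Fintype.card Γ : ℝ) ≤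
      A.card + (2 * ((q : ℝ) ^ d * Real.exp (-(4 * d / q ^ 4))) + 2 ^ d) := by
    have h1 := card_atypical_le (d := d) hq
    have h2 : ((Finset.univ.filter fun v : Γ => v = -v).card : ℝ) ≤ 2 ^ d := by
      exact_mod_cast card_eq_neg_le (d := d) (q := q)
    have h3 : (Finset.univ : Finset Γ) ⊆ A ∪ ((Finset.univ.filter fun v : Γ =>
        (d : ℝ) ≤ |(torusSq v : ℝ) - d * torusMean q|) ∪
          (Finset.univ.filter fun v : Γ => v = -v)) := by
      intro v _
      simp only [hA, Finset.mem_union, Finset.mem_filter, Finset.mem_univ, true_and]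
      by_cases h : v = -v
      · exact Or.inr (Or.inr h)
      · rcases lt_or_ge |(torusSq v : ℝ) - μ| d with h' | h'
        · exact Or.inl ⟨h', h⟩
        · exact Or.inr (Or.inl h')
    have h4 := (Finset.card_le_card h3).trans ((Finset.card_union_le _ _).trans
      (Nat.add_le_add_left (Finset.card_union_le _ _) _))
    rw [Finset.card_univ] at h4
    have h5 := (Nat.cast_le (α := ℝ)).2 h4
    simp only [Nat.cast_add] at h5
    linarith
  -- All elements of `A'` have squared norm at least `μ - d`. Absence of conflict therefore excludes
  -- every possible edge between the ends, whichever differences are finally kept.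
  let conf : Γ → Γ → Prop := fun v w => ∃ b c, edgeEnd torusHalf v b = edgeEnd torusHalf w c ∨
    μ - d ≤ torusSq (edgeEnd torusHalf v b - edgeEnd torusHalf w c)
  have hconf : ∀ v w, conf v w → conf w v := by
    rintro v w ⟨b, c, h⟩
    refine ⟨c, b, h.imp Eq.symm fun h => ?_⟩
    rwa [← torusSq_neg, neg_sub]
  have hconf_card : ∀ U ⊆ A', (∀ v ∈ U, ∀ w ∈ U, torusParity v = torusParity w) →
      ∀ v ∈ U, (U.filter (conf v)).card ≤ 4 * 16 ^ d := by
    intro U hU hp v hv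
    -- A conflict puts `w` in one of these four sets. Within a parity class the difference of ends
    -- determines `w`, so each set injects into a ball of squared radius `2 * d`.
    let T : Bool → Bool → Finset Γ := fun b c =>
      U.filter fun w => torusSq (edgeEnd torusHalf v b - edgeEnd torusHalf w c) ≤ 2 * d
    have hT : ∀ b c, (T b c).card ≤ 16 ^ d := fun b c => by
      refine (Finset.card_le_card_of_injOn
        (fun w => edgeEnd torusHalf v b - edgeEnd torusHalf w c) ?_ ?_).trans
        (card_torusSq_le (d := d) (q := q))
      · intro w hw
        simpa using (Finset.mem_filter.1 hw).2
      · intro w hw w' hw' h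
        have hw := (Finset.mem_filter.1 hw).1
        have hw' := (Finset.mem_filter.1 hw').1
        exact edgeEnd_torusHalf_injOn c (hp w hw w' hw') (sub_right_injective h)
    have hsub : U.filter (conf v) ⊆
        (T false false ∪ T false true) ∪ (T true false ∪ T true true) := by
      intro w hw
      obtain ⟨hwU, b, c, h⟩ := Finset.mem_filter.1 hw
      obtain ⟨c', hc'⟩ := exists_torusSq_edgeEnd_le (t := μ + d) (s := μ - d) (hp v hv w hwU)
        (by have : (0 : ℝ) ≤ d := Nat.cast_nonneg d
            linarith) (hAμ v (hU hv)).2.1 (hAμ w (hU hwU)).2.1 h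
      have hc' : (torusSq (edgeEnd torusHalf v b - edgeEnd torusHalf w c') : ℝ) ≤
          ((2 * d : ℤ) : ℝ) := by
        push_cast
        linarith
      have hm : w ∈ T b c' := Finset.mem_filter.2 ⟨hwU, Int.cast_le.1 hc'⟩
      cases b <;> cases c' <;> simp [hm]
    have h1 := Finset.card_le_card hsub
    have h2 := Finset.card_union_le (T false false ∪ T false true) (T true false ∪ T true true)
    have h3 := Finset.card_union_le (T false false) (T false true)
    have h4 := Finset.card_union_le (T true false) (T true true)
    have := hT false false
    have := hT false true
    have := hT true false
    have := hT true true
    omega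
  -- The threshold has a factor `2 ^ d` so that, by pigeonhole, some parity class is large enough
  -- for the greedy choice.
  obtain ⟨ι, _, F, hF, hFA, hFc, hcard⟩ := exists_disjoint_families hγ
    (fun f : Fin γ → Γ => ∀ j j', j ≠ j' → ¬ conf (f j) (f j'))
    (2 ^ d * ((4 * 16 ^ d + 1) * γ)) A'.card A' le_rfl (by
      intro U hU hUc
      obtain ⟨p, -, hp⟩ := Finset.exists_le_card_fiber_of_mul_le_card_of_maps_to
        (s := U) (t := (Finset.univ : Finset (Fin d → Bool))) (f := torusParity)
        (n := (4 * 16 ^ d + 1) * γ) (fun _ _ => Finset.mem_univ _) Finset.univ_nonempty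
        (by simpa using hUc)
      obtain ⟨f, hf, hfU, hfc⟩ := exists_independent_family conf hconf (4 * 16 ^ d) γ
        (U.filter fun v => torusParity v = p)
        (fun x hx => by
          convert hconf_card _ ((Finset.filter_subset _ _).trans hU) (fun v hv w hw => by
            have h1 : torusParity v = p := (Finset.mem_filter.1 hv).2
            have h2 : torusParity w = p := (Finset.mem_filter.1 hw).2
            rw [h1, h2]) x hx) hp
      exact ⟨f, hf, fun j => Finset.filter_subset _ _ (hfU j), hfc⟩)
  rw [max_eq_left (Nat.one_le_iff_ne_zero.2 (by positivity))] at hcard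
  have hn' : Fintype.card Γ = n := by simp [Γ, hn, ZMod.card]
  have h0 : (0 : Γ) ∉ Set.range F := by
    rintro ⟨p, hp⟩
    exact (hAμ _ (hFA p)).2.2 hp
  obtain ⟨G, φ, h𝓜⟩ := exists_rsDecomposition_cayley hn' torusHalf F hF
    (fun p p' => hneg _ (hFA p) _ (hFA p')) h0 (by
      intro i j j' b b' hj
      have := hFc i j j' hj
      refine ⟨fun h => this ⟨b, b', Or.inl h⟩, ?_⟩
      rintro ⟨p, hp⟩
      refine this ⟨b, b', Or.inr ?_⟩
      rw [← hp]
      exact (hAμ _ (hFA p)).1)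
  have hdeg := card_not_adj_symCayley F hF (fun p p' => hneg _ (hFA p) _ (hFA p')) h0
  refine ⟨Fintype.card ι, G, h𝓜, ?_, fun u => ?_⟩
  · have := hdeg 0
    rw [hn', Fintype.card_prod, Fintype.card_fin] at this
    omega
  · have h1 : (Finset.univ.filter fun v => ¬ G.Adj u v).card =
        (Finset.univ.filter fun y => ¬ (symCayley (Set.range F) h0).Adj (φ u) y).card := by
      refine Finset.card_bij (fun v _ => φ v) ?_ (fun _ _ _ _ h => φ.injective h) ?_
      · intro v hv
        exact Finset.mem_filter.2 ⟨Finset.mem_univ _,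
          fun h => (Finset.mem_filter.1 hv).2 (φ.map_adj_iff.1 h)⟩
      · intro y hy
        obtain ⟨v, rfl⟩ := φ.surjective y
        exact ⟨v, Finset.mem_filter.2 ⟨Finset.mem_univ _,
          fun h => (Finset.mem_filter.1 hy).2 (φ.map_adj_iff.2 h)⟩, rfl⟩
    have h2 := hdeg (φ u)
    rw [h1]
    have h3 : (((Finset.univ.filter fun y =>
        ¬ (symCayley (Set.range F) h0).Adj (φ u) y).card : ℝ)) + A.card ≤
          Fintype.card Γ + 2 * (2 ^ d * ((4 * 16 ^ d + 1) * γ)) := by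
      -- The degree is twice the number of packed differences, and `A.card ≤ 2 * A'.card`; so the
      -- unpacked part of `A'` is counted twice.
      have h4 : (Finset.univ.filter fun y =>
        ¬ (symCayley (Set.range F) h0).Adj (φ u) y).card + A.card ≤
          Fintype.card Γ + 2 * (2 ^ d * ((4 * 16 ^ d + 1) * γ)) := by omega
      exact_mod_cast h4
    linarith

/-! ### The Ruzsa-Szemerédi scheme -/

theorem dist_le_sqrt_two_of_mem_unitSquare {x y : EuclideanSpace ℝ (Fin 2)}
    (hx : ∀ i, x i ∈ Set.Icc (0 : ℝ) 1) (hy : ∀ i, y i ∈ Set.Icc (0 : ℝ) 1) : dist x y ≤ √2 := by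
  rw [EuclideanSpace.dist_eq, Fin.sum_univ_two]
  refine Real.sqrt_le_sqrt ?_
  have h : ∀ i, dist (x i) (y i) ^ 2 ≤ 1 := fun i => by
    rw [Real.dist_eq, sq_abs]
    obtain ⟨h1, h2⟩ := hx i
    obtain ⟨h3, h4⟩ := hy i
    nlinarith
  linarith [h 0, h 1]

/-- Users transmit one after the other, each to all the other users. -/
def roundRobin (n : ℕ) (s : ℕ) : Set (Fin n × Fin n) := {l | (l.1 : ℕ) = s % n ∧ l.1 ≠ l.2}

/-- Only one user transmits at a time, so the interference condition is vacuous, and `√2` bounds all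
distances in the square. -/
theorem feasible_roundRobin {n : ℕ} (net : D2DNetwork n) (hr : √2 ≤ net.r) (s : ℕ) :
    net.Feasible (roundRobin n s) := by
  rintro l ⟨h1, h2⟩
  refine ⟨h2, (dist_le_sqrt_two_of_mem_unitSquare (net.pos_mem _) (net.pos_mem _)).trans hr, ?_⟩
  rintro l' ⟨h3, -⟩ h4
  exact absurd (Fin.ext (h3.trans h1.symm)) h4

theorem mem_receivedFrom_roundRobin {n : ℕ} {u v : Fin n} (h : v ≠ u) :
    v ∈ receivedFrom (roundRobin n) u := by
  refine Filter.frequently_atTop.2 fun s => ⟨n * s + v, ?_, ?_, h⟩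
  · exact (Nat.le_mul_of_pos_left s (by have := v.2; omega)).trans (Nat.le_add_right _ _)
  · simp [Nat.mod_eq_of_lt v.2]

section Scheme

variable {n γ τ m L : ℕ} {G : SimpleGraph (Fin n)}

/-- The partner of a node is cached by all the other nodes of the matching. -/
theorem mem_rsCached_node (𝓜 : RSDecomposition G γ τ) (t : Fin τ) {p q : Fin γ × Bool} (hq : q ≠ p)
    (i : Fin m) (k : Fin (2 * γ - 1)) :
    (i, (𝓜.matching t).node (p.1, !p.2), k) ∈ rsCached G γ m ((𝓜.matching t).node q) := by
  simp only [rsCached, Finset.mem_filter, Finset.mem_univ, true_and, (𝓜.matching t).adj_iff]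
  rintro ⟨h1, h2⟩
  refine hq (Prod.ext h1 ?_)
  simpa using h2

theorem message_rsScheme (𝓜 : RSDecomposition G γ τ) (W : Library m (RSPacket n γ) L)
    (f : Fin n → Fin m) (t : Fin τ) (q : Fin γ × Bool) (b : Fin L) :
    (rsScheme 𝓜 m L).message ((𝓜.matching t).node q) W f ⟨⟨(t, q), rfl⟩, b⟩ =
      ∑ p : Fin γ × Bool, if hq : q ≠ p then
        W (f ((𝓜.matching t).node p))
          ((𝓜.matching t).node (p.1, !p.2), senderLabel p ⟨q, hq⟩) b else 0 := by
  refine Finset.sum_congr rfl fun p _ => ?_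
  by_cases hq : q ≠ p
  · simp only [hq, ne_eq, not_false_eq_true, dite_true]
    rw [dif_pos (mem_rsCached_node 𝓜 t hq _ _)]
    rfl
  · simp [hq]

/-- The file requested by a user is determined by its cache and by the messages of the others. -/
theorem requested_file_eq (𝓜 : RSDecomposition G γ τ) (u : Fin n) (f : Fin n → Fin m)
    (W W' : Library m (RSPacket n γ) L)
    (hc : (rsScheme 𝓜 m L).cacheContent u W = (rsScheme 𝓜 m L).cacheContent u W')
    (hmsg : ∀ v ≠ u, (rsScheme 𝓜 m L).message v W f = (rsScheme 𝓜 m L).message v W' f) :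
    W (f u) = W' (f u) := by
  have hcached : ∀ (i : Fin m) (v : Fin n) k, ¬ G.Adj u v → W i (v, k) = W' i (v, k) :=
    fun i v k h => congrFun hc ⟨(i, v, k), by
      simpa [rsScheme, rsCached] using h⟩
  funext ⟨v, k⟩
  by_cases huv : G.Adj u v
  swap
  · exact hcached _ _ _ huv
  have hedge : s(u, v) ∈ ⋃ t, (𝓜.matching t).edges := by
    rw [𝓜.cover]; exact huv
  obtain ⟨t, i, hi⟩ := Set.mem_iUnion.1 hedge
  obtain ⟨p, rfl, rfl⟩ : ∃ p : Fin γ × Bool, (𝓜.matching t).node p = u ∧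
      (𝓜.matching t).node (p.1, !p.2) = v := by
    rcases Sym2.eq_iff.1 hi with ⟨h1, h2⟩ | ⟨h1, h2⟩
    · exact ⟨(i, false), h1, h2⟩
    · exact ⟨(i, true), h2, h1⟩
  obtain ⟨⟨q, hq⟩, rfl⟩ := (senderLabel p).surjective k
  funext b
  have h := congrFun (hmsg _ fun h => hq ((𝓜.matching t).node_injective h)) ⟨⟨(t, q), rfl⟩, b⟩
  rw [message_rsScheme, message_rsScheme, ← Finset.add_sum_erase _ _ (Finset.mem_univ p),
    ← Finset.add_sum_erase _ _ (Finset.mem_univ p), dif_pos hq, dif_pos hq] at h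
  rw [Finset.sum_congr rfl (g := fun p' : Fin γ × Bool => if hq' : q ≠ p' then
        W' (f ((𝓜.matching t).node p'))
          ((𝓜.matching t).node (p'.1, !p'.2), senderLabel p' ⟨q, hq'⟩) b else 0)] at h
  · exact add_right_cancel h
  · intro p' hp'
    have hne := Finset.ne_of_mem_erase hp'
    by_cases hq' : q ≠ p'
    -- Inside the matching, `p` is adjacent only to its own partner. The packet meant for `p' ≠ p`
    -- belongs to another vertex and is thus cached by `p`.
    · rw [dif_pos hq', dif_pos hq', hcached]
      rw [(𝓜.matching t).adj_iff]
      rintro ⟨h1, h2⟩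
      exact hne (Prod.ext h1.symm (by simpa using h2.symm))
    · rw [dif_neg hq', dif_neg hq']

/-- The decoder picks any library consistent with what the user sees; by `requested_file_eq` all of
them agree on the requested file. -/
theorem exists_decoder_rsScheme (𝓜 : RSDecomposition G γ τ) {D : Fin n → Set (Fin n)}
    (hD : ∀ u v, v ≠ u → v ∈ D u) :
    ∃ dec : (rsScheme 𝓜 m L).Decoder D, (rsScheme 𝓜 m L).errorProb dec = 0 := by
  classical
  let good : ∀ u : Fin n, (∀ v : D u, (rsScheme 𝓜 m L).Msg v → ZMod 2) →
      ((rsScheme 𝓜 m L).cached u → Fin L → ZMod 2) → (Fin n → Fin m) →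
      Library m (RSPacket n γ) L → Prop := fun u X Z f W =>
    (fun v : D u => (rsScheme 𝓜 m L).message v W f) = X ∧ (rsScheme 𝓜 m L).cacheContent u W = Z
  refine ⟨fun u X Z f => if h : ∃ W, good u X Z f W then h.choose (f u) else 0, ?_⟩
  unfold D2DScheme.errorProb
  have hzero : ∀ (f : Fin n → Fin m) (u : Fin n), (Nat.card {W : Library m (RSPacket n γ) L //
      (rsScheme 𝓜 m L).estimate (D := D)
        (fun u X Z f => if h : ∃ W, good u X Z f W then h.choose (f u) else 0) u W f ≠
          W (f u)} : ℝ) = 0 := by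
    intro f u
    rw [Nat.cast_eq_zero, Nat.card_eq_zero]
    left
    refine ⟨fun ⟨W, hW⟩ => hW ?_⟩
    have h : ∃ W', good u (fun v => (rsScheme 𝓜 m L).message v W f)
      ((rsScheme 𝓜 m L).cacheContent u W) f W' := ⟨W, rfl, rfl⟩
    unfold D2DScheme.estimate
    beta_reduce
    rw [dif_pos h]
    exact requested_file_eq 𝓜 u f _ _ h.choose_spec.2
      fun v hv => congrFun h.choose_spec.1 ⟨v, hD u v hv⟩
  simp only [hzero, zero_div, Real.iSup_const_zero]

theorem rate_rsScheme (𝓜 : RSDecomposition G γ τ) :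
    (rsScheme 𝓜 m L).rate = (τ * (2 * γ) * L : ℝ) / (n * (2 * γ - 1 : ℕ) * L : ℝ) := by
  have h : ∑ u, Nat.card ((rsScheme 𝓜 m L).Msg u) = τ * (2 * γ) * L := by
    have h1 : ∀ u, Nat.card ((rsScheme 𝓜 m L).Msg u) =
        Nat.card {x : Fin τ × (Fin γ × Bool) // (𝓜.matching x.1).node x.2 = u} * L := fun u => by
      change Nat.card ({x : Fin τ × (Fin γ × Bool) // (𝓜.matching x.1).node x.2 = u} × Fin L) = _
      rw [Nat.card_prod, Nat.card_fin]
    rw [Finset.sum_congr rfl fun u _ => h1 u, ← Finset.sum_mul]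
    congr 1
    -- The transmissions grouped by sender are the fibres of `(t, q) ↦ node q`, so their total is
    -- the number of pairs `(t, q)`.
    rw [← Nat.card_sigma,
      Nat.card_congr (Equiv.sigmaFiberEquiv fun x : Fin τ × (Fin γ × Bool) =>
        (𝓜.matching x.1).node x.2)]
    simp [mul_comm]
  unfold D2DScheme.rate
  rw [← Nat.cast_sum, h]
  simp

open Classical in
theorem card_rsCached (G : SimpleGraph (Fin n)) (γ m : ℕ) (u : Fin n) :
    (rsCached G γ m u).card =
      m * ((Finset.univ.filter fun v => ¬ G.Adj u v).card * (2 * γ - 1)) := by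
  have : rsCached G γ m u = (Finset.univ : Finset (Fin m)) ×ˢ
      ((Finset.univ.filter fun v => ¬ G.Adj u v) ×ˢ (Finset.univ : Finset (Fin (2 * γ - 1)))) := by
    ext ⟨i, v, k⟩
    simp [rsCached]
  rw [this]
  simp

open Classical in
theorem achieves_rsScheme (𝓜 : RSDecomposition G γ τ) (hγ : 1 ≤ γ) (net : D2DNetwork n)
    (hr : √2 ≤ net.r) {M R : ℝ}
    (hM : ∀ u, (m * (Finset.univ.filter fun v => ¬ G.Adj u v).card : ℝ) ≤ M * n)
    (hR : R = (τ : ℝ) / n * (2 * γ / (2 * γ - 1))) :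
    Achieves net (fun L => rsScheme 𝓜 m L) M R := by
  have hsub : ((2 * γ - 1 : ℕ) : ℝ) = 2 * γ - 1 := by
    rw [Nat.cast_sub (by omega)]; push_cast; ring
  refine ⟨fun L u => ?_, fun η hη => ?_, roundRobin n, feasible_roundRobin net hr, fun ε hε => ?_⟩
  · change ((rsCached G γ m u).card : ℝ) ≤ _
    rw [card_rsCached]
    simp only [Nat.cast_mul, Nat.card_prod, Nat.card_fin, ← mul_assoc]
    exact mul_le_mul_of_nonneg_right (hM u) (Nat.cast_nonneg _)
  · filter_upwards [eventually_gt_atTop 0] with L hL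
    have hL : (L : ℝ) ≠ 0 := by positivity
    rw [rate_rsScheme, hsub, hR, mul_div_mul_right _ _ hL, mul_div_mul_comm]
    linarith
  · choose dec hdec using fun L => exists_decoder_rsScheme (m := m) (L := L) 𝓜
      (D := receivedFrom (roundRobin n)) fun _ _ => mem_receivedFrom_roundRobin
    exact ⟨dec, fun η hη => Eventually.of_forall fun L => by rw [hdec]; linarith⟩

end Scheme

/-! ### The parameters -/

theorem log_pow_rpow_rsDelta {Λ : ℕ} (hΛ : 1 < Λ) (z : ℕ) :
    (((Λ ^ z : ℕ) : ℝ)) ^ rsDelta Λ = ((10.5 : ℝ) ^ 2) ^ z := by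
  have hl : 0 < Real.log Λ := Real.log_pos (by exact_mod_cast hΛ)
  have hΛ0 : (0 : ℝ) < Λ := by positivity
  rw [Real.rpow_def_of_pos (by positivity), Nat.cast_pow, Real.log_pow, rsDelta,
    ← pow_mul, ← Real.exp_log (show (0 : ℝ) < 10.5 ^ (2 * z) by positivity), Real.log_pow]
  congr 1
  push_cast
  field_simp

/-- The bound on the number of non-neighbours in terms of the exponent of the cache size. -/
theorem nonneighbour_bound {Λ z γ : ℕ} (hΛ : 111 ≤ Λ) (hz : 222 ≤ z) (hz' : Λ ^ 4 ≤ z)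
    (hγ : (γ : ℝ) ≤ 2 * (Λ / 10.5 ^ 2) ^ z) :
    2 * ((Λ : ℝ) ^ z * Real.exp (-(4 * z / Λ ^ 4))) + 2 ^ z +
        2 * (2 ^ z * ((4 * 16 ^ z + 1) * γ)) ≤
      2 * Λ ^ z * Real.exp (-(z / (2 * Λ ^ 4))) := by
  have hΛr : (111 : ℝ) ≤ Λ := by exact_mod_cast hΛ
  have hz4 : (Λ : ℝ) ^ 4 ≤ z := by exact_mod_cast hz'
  have hx0 : (0 : ℝ) < Λ ^ 4 := by positivity
  set E := Real.exp (-((z : ℝ) / (2 * Λ ^ 4))) with hE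
  have hE0 : 0 < E := Real.exp_pos _
  have h8 : Real.exp (-(4 * (z : ℝ) / Λ ^ 4)) = E * E ^ 7 := by
    rw [hE, ← Real.exp_nat_mul, ← Real.exp_add]
    congr 1
    push_cast
    field_simp
    norm_num
  -- The first term is `2 * Λ ^ z * E ^ 8`, so it takes up one half of the target `2 * Λ ^ z * E`.
  have h7 : E ^ 7 ≤ 1 / 2 := by
    rw [hE, ← Real.exp_nat_mul]
    calc _ ≤ Real.exp (-1) := by
          apply Real.exp_le_exp.2
          have : (1 : ℝ) / 2 ≤ z / (2 * Λ ^ 4) := by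
            rw [div_le_div_iff₀ (by norm_num) (by positivity)]
            linarith
          push_cast
          linarith
      _ ≤ 1 / 2 := by
          rw [Real.exp_neg, inv_le_comm₀ (Real.exp_pos _) (by norm_num)]
          have := Real.add_one_le_exp (1 : ℝ)
          linarith
  have hhalf : ((1 : ℝ) / 2) ^ z ≤ E := by
    have h1 : (1 : ℝ) / 2 ≤ Real.exp (-(1 / (2 * Λ ^ 4))) := by
      have h2 := Real.add_one_le_exp (-(1 / (2 * (Λ : ℝ) ^ 4)))
      have h3 : 1 / (2 * (Λ : ℝ) ^ 4) ≤ 1 / 2 := by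
        apply one_div_le_one_div_of_le (by norm_num)
        nlinarith [one_le_pow₀ (by linarith : (1 : ℝ) ≤ Λ) (n := 4)]
      linarith
    calc ((1 : ℝ) / 2) ^ z ≤ (Real.exp (-(1 / (2 * Λ ^ 4)))) ^ z :=
          pow_le_pow_left₀ (by norm_num) h1 z
      _ = E := by
          rw [hE, ← Real.exp_nat_mul]
          congr 1
          ring
  -- The other two terms must fit in `Λ ^ z * E`: they are at most `1 + 20` times `Λ ^ z * (1 / 3) ^
  -- z`.
  have h21 : (21 : ℝ) * (1 / 3) ^ z ≤ (1 / 2) ^ z := by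
    have h1 : (21 : ℝ) ≤ (3 / 2) ^ z :=
      calc (21 : ℝ) ≤ (3 / 2) ^ 8 := by norm_num
        _ ≤ (3 / 2) ^ z := pow_le_pow_right₀ (by norm_num) (by omega)
    calc (21 : ℝ) * (1 / 3) ^ z ≤ (3 / 2) ^ z * (1 / 3) ^ z := by gcongr
      _ = (1 / 2) ^ z := by rw [← mul_pow]; norm_num
  have ha : (2 : ℝ) ^ z ≤ Λ ^ z * (1 / 3) ^ z := by
    rw [← mul_pow]
    exact pow_le_pow_left₀ (by norm_num) (by linarith) z
  have hb : (2 : ℝ) * (2 ^ z * ((4 * 16 ^ z + 1) * γ)) ≤ 20 * (Λ ^ z * (1 / 3) ^ z) := by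
    have h16 : (1 : ℝ) ≤ 16 ^ z := one_le_pow₀ (by norm_num)
    calc (2 : ℝ) * (2 ^ z * ((4 * 16 ^ z + 1) * γ))
        ≤ 2 * (2 ^ z * ((5 * 16 ^ z) * (2 * (Λ / 10.5 ^ 2) ^ z))) := by
          gcongr
          linarith
      -- Here the value 10.5 matters: `2 * 16 / 10.5 ^ 2 < 1 / 3`, with 2 from the parities and 16
      -- from the ball.
      _ = 20 * (2 * 16 * (Λ / 10.5 ^ 2)) ^ z := by
          rw [mul_pow, mul_pow]; ring
      _ ≤ 20 * (Λ * (1 / 3)) ^ z := by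
          refine mul_le_mul_of_nonneg_left (pow_le_pow_left₀ (by positivity) ?_ z) (by norm_num)
          rw [div_eq_mul_inv, mul_comm (Λ : ℝ), ← mul_assoc, mul_comm (Λ : ℝ)]
          exact mul_le_mul_of_nonneg_right (by norm_num) (by linarith)
      _ = _ := by rw [mul_pow]
  have hΛz : (0 : ℝ) < Λ ^ z := by positivity
  have hc : (Λ : ℝ) ^ z * (21 * (1 / 3) ^ z) ≤ Λ ^ z * E :=
    mul_le_mul_of_nonneg_left (h21.trans hhalf) hΛz.le
  have hd : (Λ : ℝ) ^ z * (E * E ^ 7) ≤ Λ ^ z * (E * (1 / 2)) := by gcongr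
  rw [h8]
  linarith

/-- For `z ≤ Λ ^ 4` the claimed cache size already allows every user to store the whole library. -/
theorem one_le_two_mul_exp_neg {Λ z : ℕ} (hz : z ≤ Λ ^ 4) (hΛ : 0 < Λ) :
    (1 : ℝ) ≤ 2 * Real.exp (-(z / (2 * (Λ : ℝ) ^ 4))) := by
  have h1 : (z : ℝ) ≤ (Λ : ℝ) ^ 4 := by exact_mod_cast hz
  have h2 : (z : ℝ) / (2 * Λ ^ 4) ≤ 1 / 2 := by
    rw [div_le_div_iff₀ (by positivity) (by norm_num)]
    linarith
  have := Real.add_one_le_exp (-(z / (2 * (Λ : ℝ) ^ 4)))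
  linarith

/-- With these constants `c₁ δ = 1 / (2 ln Λ)` and `c₂ / δ = 4 ln Λ`. -/
theorem cacheExponent_eq {Λ : ℕ} (hΛ : 1 < Λ) :
    1 / (4 * Real.log 10.5) * rsDelta Λ * Real.exp (-(8 * Real.log 10.5) / rsDelta Λ) =
      1 / (2 * (Λ : ℝ) ^ 4 * Real.log Λ) := by
  have hl : 0 < Real.log Λ := Real.log_pos (by exact_mod_cast hΛ)
  have ha : 0 < Real.log 10.5 := Real.log_pos (by norm_num)
  have hΛ0 : (0 : ℝ) < Λ := by positivity
  have he : -(8 * Real.log 10.5) / rsDelta Λ = -Real.log ((Λ : ℝ) ^ 4) := by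
    rw [rsDelta, Real.log_pow]
    push_cast
    field_simp
    norm_num
  rw [he, Real.exp_neg, Real.exp_log (by positivity), rsDelta]
  field_simp
  norm_num

theorem pow_rpow_neg_cacheExponent {Λ : ℕ} (hΛ : 1 < Λ) (z : ℕ) :
    ((Λ ^ z : ℕ) : ℝ) ^ (-(1 / (2 * (Λ : ℝ) ^ 4 * Real.log Λ))) =
      Real.exp (-(z / (2 * (Λ : ℝ) ^ 4))) := by
  have hl : 0 < Real.log Λ := Real.log_pos (by exact_mod_cast hΛ)
  have hΛ0 : (0 : ℝ) < Λ := by positivity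
  rw [Real.rpow_def_of_pos (by positivity), Nat.cast_pow, Real.log_pow]
  congr 1
  field_simp

/-! ### Choice of the parameters and assembly. -/

theorem corollary1 :
    ∃ (c₁ c₂ C : ℝ) (g : ℕ → ℝ), 0 < c₁ ∧ 0 < c₂ ∧ Tendsto g atTop (𝓝 0) ∧
      ∀ (Λ z n : ℕ) (δ : ℝ), (10.5 : ℝ) ^ 2 < Λ → 2 * Λ ≤ z → n = Λ ^ z → δ = rsDelta Λ →
        c₁ * δ * Real.exp (-c₂ / δ) = 1 / (2 * (Λ : ℝ) ^ 4 * Real.log Λ) ∧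
        ∃ (γ τ : ℕ) (G : SimpleGraph (Fin n)) (𝓜 : RSDecomposition G γ τ), 1 ≤ γ ∧
          ((Nat.card (RSPacket n γ) : ℕ) : ℝ) ≤ C * (n : ℝ) ^ (2 - δ) ∧
          ∃ R : ℝ, R = (τ : ℝ) / n * (2 * γ / (2 * γ - 1)) ∧
            R ≤ (n : ℝ) ^ δ + g n * (n : ℝ) ^ δ ∧
            ∀ (m : ℕ) (M : ℝ) (net : D2DNetwork n), √2 ≤ net.r →
              M = 2 * m * (n : ℝ) ^ (-(c₁ * δ * Real.exp (-c₂ / δ))) →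
              Achieves net (fun L => rsScheme 𝓜 m L) M R := by
  classical
  have ha : 0 < Real.log 10.5 := Real.log_pos (by norm_num)
  refine ⟨1 / (4 * Real.log 10.5), 8 * Real.log 10.5, 3, fun _ => 0, by positivity, by positivity,
    tendsto_const_nhds, ?_⟩
  rintro Λ z n δ hΛ hz hn rfl
  have hΛ111 : 111 ≤ Λ := by
    have h : ((110 : ℕ) : ℝ) < Λ := lt_trans (by norm_num) hΛ
    exact Nat.cast_lt.1 h
  have hΛ1 : 1 < Λ := by omega
  have hexp := cacheExponent_eq hΛ1
  refine ⟨hexp, ?_⟩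
  have : NeZero Λ := ⟨by omega⟩
  have hΛ0 : (0 : ℝ) < Λ := by positivity
  have hn0 : (0 : ℝ) < n := by rw [hn]; positivity
  -- This is `n ^ (1 - δ)`.
  set x : ℝ := (Λ / 10.5 ^ 2) ^ z with hx
  have hx1 : 1 ≤ x := one_le_pow₀ (by rw [le_div_iff₀ (by norm_num)]; linarith)
  have hδ : (n : ℝ) ^ rsDelta Λ = (10.5 ^ 2) ^ z := by rw [hn]; exact log_pow_rpow_rsDelta hΛ1 z
  have hδ0 : 0 < (n : ℝ) ^ rsDelta Λ := by positivity
  have hxn : x * (n : ℝ) ^ rsDelta Λ = n := by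
    rw [hδ, hx, ← mul_pow, div_mul_cancel₀ _ (by norm_num), hn, Nat.cast_pow]
  -- The least `γ` with `2 γ - 1 ≥ x`, as the rate bound requires. Since `x ≥ 1`, also `2 γ - 1 ≤ 3
  -- x`, which gives `C = 3`, and `γ ≤ 2 x`.
  set γ : ℕ := ⌈(x + 1) / 2⌉₊ with hγ
  have hγ1 : (x + 1) / 2 ≤ γ := Nat.le_ceil _
  have hγ2 : (γ : ℝ) < (x + 1) / 2 + 1 := Nat.ceil_lt_add_one (by linarith)
  have hγpos : 1 ≤ γ := by
    have : (1 : ℝ) ≤ γ := by linarith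
    exact_mod_cast this
  obtain ⟨k, G, ⟨𝓜⟩, hk, hdeg⟩ := exists_rsDecomposition_torus (d := z) (by omega) hn hγpos
  refine ⟨γ, n * k, G, 𝓜, hγpos, ?_, _, rfl, ?_, ?_⟩
  · rw [Nat.card_prod, Nat.card_fin, Nat.card_fin, Nat.cast_mul, Nat.cast_sub (by omega),
      Real.rpow_sub hn0, Real.rpow_two]
    have : (n : ℝ) ^ 2 / (n : ℝ) ^ rsDelta Λ = n * x := by
      rw [div_eq_iff hδ0.ne', mul_assoc, hxn, sq]
    rw [this, mul_left_comm]
    push_cast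
    gcongr
    linarith
  · have hk' : (2 * (k * γ) : ℝ) ≤ n := by exact_mod_cast hk
    rw [zero_mul, add_zero, Nat.cast_mul, mul_div_cancel_left₀ _ hn0.ne', ← mul_div_assoc,
      div_le_iff₀ (by linarith)]
    calc (k : ℝ) * (2 * γ) ≤ n := by linarith
      _ = (n : ℝ) ^ rsDelta Λ * x := by rw [mul_comm, hxn]
      _ ≤ (n : ℝ) ^ rsDelta Λ * (2 * γ - 1) := by
          gcongr
          linarith
  · intro m M net hr hM
    refine achieves_rsScheme 𝓜 hγpos net hr (fun u => ?_) rfl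
    have hbound : ((Finset.univ.filter fun v => ¬ G.Adj u v).card : ℝ) ≤
        2 * n * Real.exp (-(z / (2 * (Λ : ℝ) ^ 4))) := by
      -- The concentration estimate is useful only for `z ≥ Λ ^ 4`; below that the trivial bound `n`
      -- suffices.
      rcases le_total z (Λ ^ 4) with h4 | h4
      · have h1 := one_le_two_mul_exp_neg h4 (by omega)
        have h2 : ((Finset.univ.filter fun v => ¬ G.Adj u v).card : ℝ) ≤ n := by
          exact_mod_cast (Finset.card_le_univ _).trans_eq (Fintype.card_fin n)
        nlinarith
      · refine (hdeg u).trans ?_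
        rw [hn, Nat.cast_pow]
        exact nonneighbour_bound hΛ111 (by omega) h4 (by rw [← hx]; linarith)
    have hpow : (n : ℝ) ^ (-(1 / (2 * (Λ : ℝ) ^ 4 * Real.log Λ))) =
        Real.exp (-(z / (2 * (Λ : ℝ) ^ 4))) := by
      rw [hn]; exact pow_rpow_neg_cacheExponent hΛ1 z
    rw [hM, hexp, hpow]
    calc _ ≤ (m : ℝ) * (2 * n * Real.exp (-(z / (2 * (Λ : ℝ) ^ 4)))) := by gcongr
      _ = _ := by ring
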